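/- Let $T,K,n_1,\dots,n_K$ be positive integers and $m$ a non-negative integer. For $k\in[K]$ let $C_k,A_{1,k},\dots,A_{m,k}$ be real symmetric $n_k\times n_k$ matrices, let $\eta_k>0$, $0<\beta_k\le 1/2$ and $0<\ell_k\le\rho_k$, and let $[T]=\mathcal P_k\cup\mathcal N_k$ be a partition into two disjoint (possibly empty) sets. Write $[r]=\{1,\dots,r\}$, $\langle X,Y\rangle=\operatorname{tr}(XY)$, $X\succeq Y$ if $X-Y$ is positive semidefinite, and $X\in[a,b]$ if $aI\preceq X\preceq bI$. Let $y^{(t)}\in\mathbb R^m$ for $t\in[T]$, and for $k\in[K]$ let $\ell_k^{(t)}\in\mathbb R$ and real symmetric $n_k\times n_k$ matrices $W_k^{(t)}$ be given for $t\in[T+1]$. Suppose that: 1. for all $t\in\{0,\dots,T\}$ and $k\in[K]$, $$W_k^{(t+1)}=\exp\Bigl(-\frac{\beta_k}{\ell_k+\rho_k}\sum_{\tau=1}^{t}\Bigl[\sum_{i=1}^m y_i^{(\tau)}A_{i,k}-C_k+\ell_k^{(\tau)}I\Bigr]\Bigr);$$ 2. for all $t\in[T]$, $y^{(t)}\ge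 0$ entrywise and $$\sum_{i=1}^m y_i^{(t)}\langle A_{i,k},W_k^{(t)}\rangle\ \ge\ \langle C_k,W_k^{(t)}\rangle-\eta_k\operatorname{tr}W_k^{(t)}\qquad\text{for all }k\in[K];$$ 3. for all $t\in[T]$ and $k\in[K]$, $\sum_{i=1}^m y_i^{(t)}A_{i,k}-C_k$ lies in $[-\ell_k,\rho_k]$ if $t\in\mathcal P_k$, and in $[-\rho_k,\ell_k]$ if $t\in\mathcal N_k$; 4. for all $k\in[K]$, $\ell_k^{(t)}=\ell_k$ for $t\in\mathcal P_k$ and $\ell_k^{(t)}=-\ell_k$ for $t\in\mathcal N_k$. Let $\bar y=\frac1T\sum_{t=1}^T y^{(t)}$. Then, for every $k\in[K]$, $$\sum_{i=1}^m\bar y_iA_{i,k}-C_k\ \succeq\ -\Bigl[\beta_k\ell_k+\frac{(\rho_k+\ell_k)\ln n_k}{T\beta_k}+(1+\beta_k)\eta_k\Bigr]I.$$ -/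

import Mathlib

open scoped MatrixOrder

namespace BlockMMWUM

/-- The trace inner product `⟨X, Y⟩ = tr (X Y)` of square real matrices. -/
def traceInner {n : ℕ} (X Y : Matrix (Fin n) (Fin n) ℝ) : ℝ :=
  (X * Y).trace

/-- `X ∈ [a, b]`, i.e. `a I ⪯ X ⪯ b I`. Here `≤` is the Loewner order on matrices:
`X ≤ Y` means that `Y - X` is positive semidefinite. -/
def InInterval {n : ℕ} (X : Matrix (Fin n) (Fin n) ℝ) (a b : ℝ) : Prop :=
  a • (1 : Matrix (Fin n) (Fin n) ℝ) ≤ X ∧ X ≤ b • (1 : Matrix (Fin n) (Fin n) ℝ)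

/-- The slack `∑ i, y i A_{i,k} - C_k` of one block, with `A i = A_{i,k}` and `C = C_k`. -/
def slack {m n : ℕ} (A : Fin m → Matrix (Fin n) (Fin n) ℝ) (C : Matrix (Fin n) (Fin n) ℝ)
    (y : Fin m → ℝ) : Matrix (Fin n) (Fin n) ℝ :=
  ∑ i, y i • A i - C

/-- `y` solves the block oracle system with data `A i k = A_{i,k}`, `C k`, `η k` at the matrices
`X k`: `∑ i, y i ⟨A_{i,k}, X_k⟩ ≥ ⟨C_k, X_k⟩ - η_k tr X_k` for every block `k`, and `y ≥ 0`. -/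
def SolvesOracle {K m : ℕ} {n : Fin K → ℕ}
    (A : Fin m → ∀ k, Matrix (Fin (n k)) (Fin (n k)) ℝ)
    (C : ∀ k, Matrix (Fin (n k)) (Fin (n k)) ℝ) (η : Fin K → ℝ)
    (X : ∀ k, Matrix (Fin (n k)) (Fin (n k)) ℝ) (y : Fin m → ℝ) : Prop :=
  (∀ k, ∑ i, y i * traceInner (A i k) (X k) ≥
      traceInner (C k) (X k) - η k * (X k).trace) ∧
    ∀ i, 0 ≤ y i

end BlockMMWUM

/-! Blocks decouple: fix one and use the potential tr exp(H), with H the exponent of the weight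
matrix. After shifting by `L` = ±ℓ, the slack or its negative equals (ℓ + ρ)M with 0 ⪯ M ⪯ I, so one
update moves H by ∓βM. The step bounds are tr exp(H - sM) ≤ tr exp H - s(1 - s) tr(M exp H)
(`trace_exp_sub_smul_le`) and the analogue with s(1 + s) for +sM (`trace_exp_add_smul_le`). The
oracle inequality turns them into a multiplicative decrease of the potential
(`trace_exp_exponent_le`). Since the largest eigenvalue of H is at most log tr exp(H), the final
potential bounds the summed slack from below.

The step bounds do not pass through Golden–Thompson. In the eigenbases of two symmetric matrices the
traces become double sums with common nonnegative weights (`exists_trace_eq_sum`), so inequalities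
in two real variables lift termwise. -/

namespace BlockMMWUM

open Matrix NormedSpace

/-! ### Scalar inequalities for the exponential. -/

section ScalarInequalities

lemma exp_sub_one_le_half_mul {x : ℝ} (hx : 0 ≤ x) :
    Real.exp x - 1 ≤ x / 2 * (Real.exp x + 1) := by
  have hd : ∀ z : ℝ, HasDerivAt (fun z => z / 2 * (Real.exp z + 1) - Real.exp z)
      (1 / 2 * (Real.exp z + 1) + z / 2 * Real.exp z - Real.exp z) z := fun z =>
    (((hasDerivAt_id z).div_const 2).mul ((Real.hasDerivAt_exp z).add_const 1)).sub
      (Real.hasDerivAt_exp z)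
  have hm : Monotone (fun z : ℝ => z / 2 * (Real.exp z + 1) - Real.exp z) := by
    refine monotone_of_deriv_nonneg (fun z => (hd z).differentiableAt) fun z => ?_
    rw [(hd z).deriv]
    -- The derivative is (1 + (z - 1)e^z)/2, nonnegative because 1 - z ≤ e^(-z).
    have h1 := Real.add_one_le_exp (-z)
    have h2 : Real.exp (-z) * Real.exp z = 1 := by rw [← Real.exp_add]; simp
    nlinarith [Real.exp_pos z, mul_le_mul_of_nonneg_right h1 (Real.exp_pos z).le]
  have := hm hx
  simp only [Real.exp_zero] at this
  linarith

/-- The logarithmic mean of `exp a` and `exp b` is at most their arithmetic mean. -/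
lemma sub_mul_exp_sub_exp_le (a b : ℝ) :
    (b - a) * (Real.exp b - Real.exp a) ≤
      1 / 2 * ((b - a) * (b - a) * (Real.exp a + Real.exp b)) := by
  wlog hab : a ≤ b generalizing a b
  · have := this b a (le_of_not_ge hab)
    linarith
  have h := exp_sub_one_le_half_mul (sub_nonneg.2 hab)
  have he : Real.exp b = Real.exp (b - a) * Real.exp a := by rw [← Real.exp_add]; ring_nf
  have h2 := mul_le_mul_of_nonneg_left h
    (mul_nonneg (sub_nonneg.2 hab) (Real.exp_pos a).le)
  rw [he]
  linarith

lemma exp_sub_exp_le (a b : ℝ) :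
    Real.exp b - Real.exp a ≤ (b - a) * Real.exp b := by
  have h := mul_le_mul_of_nonneg_right (Real.add_one_le_exp (a - b)) (Real.exp_pos b).le
  rw [← Real.exp_add, sub_add_cancel] at h
  linarith

end ScalarInequalities

/-! ### Spectral decompositions and traces in two eigenbases. -/

section Spectral

variable {ι : Type*} [Fintype ι] [DecidableEq ι]

/-- The matrix with eigenvectors the columns of `U` and eigenvalues `f`. -/
def conjDiagonal (U : Matrix ι ι ℝ) (f : ι → ℝ) : Matrix ι ι ℝ :=
  U * diagonal f * Uᵀ

lemma conjDiagonal_mul {U : Matrix ι ι ℝ} (hU : Uᵀ * U = 1) (f g : ι → ℝ) :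
    conjDiagonal U f * conjDiagonal U g = conjDiagonal U (f * g) := by
  calc U * diagonal f * Uᵀ * (U * diagonal g * Uᵀ)
      = U * diagonal f * (Uᵀ * U) * diagonal g * Uᵀ := by simp only [Matrix.mul_assoc]
    _ = U * diagonal (f * g) * Uᵀ := by
        rw [hU, Matrix.mul_one, Matrix.mul_assoc U, diagonal_mul_diagonal]; rfl

lemma conjDiagonal_one {U : Matrix ι ι ℝ} (hU : Uᵀ * U = 1) : conjDiagonal U 1 = 1 := by
  have h : diagonal (1 : ι → ℝ) = 1 := diagonal_one
  rw [conjDiagonal, h, Matrix.mul_one, mul_eq_one_comm.1 hU]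

lemma trace_conjDiagonal_mul (U V : Matrix ι ι ℝ) (f g : ι → ℝ) :
    (conjDiagonal U f * conjDiagonal V g).trace =
      ∑ i, ∑ j, (Uᵀ * V) i j ^ 2 * (f i * g j) := by
  have h : (conjDiagonal U f * conjDiagonal V g).trace =
      (diagonal f * (Uᵀ * V) * (diagonal g * (Uᵀ * V)ᵀ)).trace := by
    rw [conjDiagonal, conjDiagonal, transpose_mul, transpose_transpose,
      show U * diagonal f * Uᵀ * (V * diagonal g * Vᵀ) =
        U * (diagonal f * Uᵀ * (V * diagonal g * Vᵀ)) by simp only [Matrix.mul_assoc],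
      trace_mul_comm]
    simp only [Matrix.mul_assoc]
  rw [h, trace]
  refine Finset.sum_congr rfl fun i _ => ?_
  rw [diag_apply, mul_apply]
  refine Finset.sum_congr rfl fun j _ => ?_
  rw [diagonal_mul, diagonal_mul, transpose_apply]
  ring

lemma posSemidef_conjDiagonal (U : Matrix ι ι ℝ) {f : ι → ℝ} (hf : 0 ≤ f) :
    (conjDiagonal U f).PosSemidef := by
  simpa [conjDiagonal, conjTranspose_eq_transpose_of_trivial] using
    (PosSemidef.diagonal hf).mul_mul_conjTranspose_same U

lemma exists_conjDiagonal {H : Matrix ι ι ℝ} (hH : H.IsHermitian) :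
    ∃ (U : Matrix ι ι ℝ) (a : ι → ℝ), Uᵀ * U = 1 ∧ H = conjDiagonal U a ∧
      exp H = conjDiagonal U (fun i => Real.exp (a i)) := by
  let U := (hH.eigenvectorUnitary : Matrix ι ι ℝ)
  have hU : Uᵀ * U = 1 := by
    simpa [star_eq_conjTranspose, conjTranspose_eq_transpose_of_trivial] using
      Unitary.coe_star_mul_self hH.eigenvectorUnitary
  have hHU : H = conjDiagonal U hH.eigenvalues := by
    have := hH.spectral_theorem
    rw [Unitary.conjStarAlgAut_apply] at this
    simpa [conjDiagonal, U, star_eq_conjTranspose, conjTranspose_eq_transpose_of_trivial] using this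
  refine ⟨U, hH.eigenvalues, hU, hHU, ?_⟩
  have hinv : U⁻¹ = Uᵀ := inv_eq_left_inv hU
  have hunit : IsUnit U := IsUnit.of_mul_eq_one_right _ hU
  conv_lhs => rw [hHU, conjDiagonal, ← hinv, exp_conj _ _ hunit, exp_diagonal, hinv]
  rw [conjDiagonal]
  congr 3
  ext i
  rw [Pi.coe_exp, Real.exp_eq_exp_ℝ]

lemma posSemidef_exp {H : Matrix ι ι ℝ} (hH : H.IsHermitian) : (exp H).PosSemidef := by
  obtain ⟨U, a, -, -, h⟩ := exists_conjDiagonal hH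
  rw [h]
  exact posSemidef_conjDiagonal U fun i => (Real.exp_pos _).le

/-- The largest eigenvalue of `H` is at most `log (tr (exp H))`. -/
lemma posSemidef_smul_one_sub {H : Matrix ι ι ℝ} (hH : H.IsHermitian) {c : ℝ}
    (hc : (exp H).trace ≤ Real.exp c) : (c • (1 : Matrix ι ι ℝ) - H).PosSemidef := by
  obtain ⟨U, a, hU, h, he⟩ := exists_conjDiagonal hH
  have ht : (exp H).trace = ∑ i, Real.exp (a i) := by
    rw [he, conjDiagonal, trace_mul_comm, ← Matrix.mul_assoc, hU, Matrix.one_mul, trace_diagonal]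
  have hcH : c • (1 : Matrix ι ι ℝ) - H = conjDiagonal U (fun i => c - a i) := by
    rw [← conjDiagonal_one hU, h, conjDiagonal, conjDiagonal, conjDiagonal, ← Matrix.smul_mul,
      ← Matrix.mul_smul, ← Matrix.sub_mul, ← Matrix.mul_sub, ← diagonal_smul, diagonal_sub]
    congr 3
    ext i
    simp
  rw [hcH]
  refine posSemidef_conjDiagonal U fun i => sub_nonneg.2 ?_
  rw [← Real.exp_le_exp]
  refine le_trans ?_ (ht ▸ hc)
  exact Finset.single_le_sum (f := fun i => Real.exp (a i)) (fun i _ => (Real.exp_pos _).le)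
    (Finset.mem_univ i)

lemma trace_mul_nonneg {A B : Matrix ι ι ℝ} (hA : A.PosSemidef) (hB : B.PosSemidef) :
    0 ≤ (A * B).trace := by
  obtain ⟨R, rfl⟩ := CStarAlgebra.nonneg_iff_eq_star_mul_self.1 hB.nonneg
  rw [← Matrix.mul_assoc, trace_mul_comm, ← Matrix.mul_assoc]
  exact (hA.mul_mul_conjTranspose_same R).trace_nonneg

/-- Traces built from `H`, `G` and their exponentials, written in the two eigenbases. -/
lemma exists_trace_eq_sum {H G : Matrix ι ι ℝ} (hH : H.IsHermitian) (hG : G.IsHermitian) :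
    ∃ (a b : ι → ℝ) (w : ι → ι → ℝ), (∀ i j, 0 ≤ w i j) ∧
      (exp H).trace = ∑ i, ∑ j, w i j * Real.exp (a i) ∧
      (exp G).trace = ∑ i, ∑ j, w i j * Real.exp (b j) ∧
      ((G - H) * exp H).trace = ∑ i, ∑ j, w i j * ((b j - a i) * Real.exp (a i)) ∧
      ((G - H) * exp G).trace = ∑ i, ∑ j, w i j * ((b j - a i) * Real.exp (b j)) ∧
      ((G - H) * (G - H) * exp H).trace =
        ∑ i, ∑ j, w i j * ((b j - a i) * (b j - a i) * Real.exp (a i)) ∧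
      ((G - H) * (G - H) * exp G).trace =
        ∑ i, ∑ j, w i j * ((b j - a i) * (b j - a i) * Real.exp (b j)) := by
  obtain ⟨U, a, hU, ha, hea⟩ := exists_conjDiagonal hH
  obtain ⟨V, b, hV, hb, heb⟩ := exists_conjDiagonal hG
  have hl : ∀ f, (conjDiagonal U f).trace = ∑ i, ∑ j, (Uᵀ * V) i j ^ 2 * f i := fun f => by
    simpa [conjDiagonal_one hV] using trace_conjDiagonal_mul U V f 1
  have hr : ∀ g, (conjDiagonal V g).trace = ∑ i, ∑ j, (Uᵀ * V) i j ^ 2 * g j := fun g => by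
    simpa [conjDiagonal_one hU] using trace_conjDiagonal_mul U V 1 g
  have hc : ∀ f g, (conjDiagonal V g * conjDiagonal U f).trace =
      ∑ i, ∑ j, (Uᵀ * V) i j ^ 2 * (f i * g j) := fun f g => by
    rw [trace_mul_comm, trace_conjDiagonal_mul]
  -- The weights are squared inner products of eigenvectors of `H` and `G`; their rows and columns
  -- sum to 1, which gives the traces involving only one matrix.
  refine ⟨a, b, fun i j => (Uᵀ * V) i j ^ 2, fun i j => sq_nonneg _, ?_, ?_, ?_, ?_, ?_, ?_⟩
  · rw [hea, hl]
  · rw [heb, hr]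
  · rw [hea, ha, hb, Matrix.sub_mul, trace_sub, conjDiagonal_mul hU, hl, hc]
    simp only [← Finset.sum_sub_distrib, Pi.mul_apply]
    exact Finset.sum_congr rfl fun i _ => Finset.sum_congr rfl fun j _ => by ring
  · rw [heb, ha, hb, Matrix.sub_mul, trace_sub, conjDiagonal_mul hV, hr, trace_conjDiagonal_mul]
    simp only [← Finset.sum_sub_distrib, Pi.mul_apply]
    exact Finset.sum_congr rfl fun i _ => Finset.sum_congr rfl fun j _ => by ring
  · have h : ((G - H) * (G - H) * exp H).trace = (G * G * exp H).trace - (G * (H * exp H)).trace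
        - (G * (exp H * H)).trace + (H * H * exp H).trace := by
      have h1 : (H * G * exp H).trace = (G * (exp H * H)).trace := by
        rw [Matrix.mul_assoc, trace_mul_comm, Matrix.mul_assoc]
      rw [← h1, ← Matrix.mul_assoc, ← trace_sub, ← trace_sub, ← trace_add]
      congr 1
      noncomm_ring
    rw [h, hea, ha, hb]
    simp only [conjDiagonal_mul hU, conjDiagonal_mul hV, hl, hc]
    simp only [← Finset.sum_sub_distrib, ← Finset.sum_add_distrib, Pi.mul_apply]
    exact Finset.sum_congr rfl fun i _ => Finset.sum_congr rfl fun j _ => by ring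
  · have h : ((G - H) * (G - H) * exp G).trace = (G * G * exp G).trace - (G * exp G * H).trace
        - (exp G * G * H).trace + (exp G * (H * H)).trace := by
      have h1 : (H * G * exp G).trace = (G * exp G * H).trace := by
        rw [Matrix.mul_assoc, trace_mul_comm]
      have h2 : (G * H * exp G).trace = (exp G * G * H).trace := by
        rw [trace_mul_comm, Matrix.mul_assoc]
      rw [← h1, ← h2, trace_mul_comm (exp G), ← trace_sub, ← trace_sub, ← trace_add]
      congr 1
      noncomm_ring
    rw [h, heb, ha, hb]
    simp only [conjDiagonal_mul hU, conjDiagonal_mul hV, hr, hc]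
    simp only [← Finset.sum_sub_distrib, ← Finset.sum_add_distrib, Pi.mul_apply]
    exact Finset.sum_congr rfl fun i _ => Finset.sum_congr rfl fun j _ => by ring

end Spectral

/-! ### Trace inequalities replacing Golden–Thompson. -/

section TraceInequalities

variable {ι : Type*} [Fintype ι] [DecidableEq ι]

/-- Klein's inequality for the exponential. -/
lemma trace_exp_sub_le {H G : Matrix ι ι ℝ} (hH : H.IsHermitian) (hG : G.IsHermitian) :
    (exp G).trace - (exp H).trace ≤ ((G - H) * exp G).trace := by
  obtain ⟨a, b, w, hw, h1, h2, -, h4, -, -⟩ := exists_trace_eq_sum hH hG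
  rw [h1, h2, h4]
  simp only [← Finset.sum_sub_distrib, ← mul_sub]
  exact Finset.sum_le_sum fun i _ => Finset.sum_le_sum fun j _ =>
    mul_le_mul_of_nonneg_left (exp_sub_exp_le _ _) (hw i j)

/-- Termwise lift of the logarithmic–arithmetic mean inequality; it controls how tr(M exp ·) changes
along M. -/
lemma trace_sub_mul_exp_sub_le {H G : Matrix ι ι ℝ} (hH : H.IsHermitian) (hG : G.IsHermitian) :
    ((G - H) * exp G).trace - ((G - H) * exp H).trace ≤
      1 / 2 * (((G - H) * (G - H) * exp H).trace + ((G - H) * (G - H) * exp G).trace) := by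
  obtain ⟨a, b, w, hw, -, -, h3, h4, h5, h6⟩ := exists_trace_eq_sum hH hG
  rw [h3, h4, h5, h6]
  simp only [← Finset.sum_sub_distrib, ← Finset.sum_add_distrib, Finset.mul_sum]
  refine Finset.sum_le_sum fun i _ => Finset.sum_le_sum fun j _ => ?_
  have := mul_le_mul_of_nonneg_left (sub_mul_exp_sub_exp_le (a i) (b j)) (hw i j)
  linarith

lemma trace_mul_self_mul_le {M B : Matrix ι ι ℝ} (h0 : M.PosSemidef) (h1 : (1 - M).PosSemidef)
    (hB : B.PosSemidef) : (M * M * B).trace ≤ (M * B).trace := by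
  have h : (M - M * M).PosSemidef := by
    -- Writing M - M² as a sum of two congruences shows positivity without diagonalizing M.
    have e : M - M * M = (1 - M) * M * (1 - M)ᴴ + M * (1 - M) * Mᴴ := by
      rw [h0.isHermitian.eq, h1.isHermitian.eq]
      noncomm_ring
    rw [e]
    exact (h0.mul_mul_conjTranspose_same _).add (h1.mul_mul_conjTranspose_same _)
  have := trace_mul_nonneg h hB
  rw [Matrix.sub_mul, trace_sub] at this
  linarith

/-- If `0 ⪯ M ⪯ I`, then `tr (M exp (H + s • M))` exceeds `tr (M exp H)` by a factor of at most
`(1 + s / 2) / (1 - s / 2)`. -/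
lemma trace_mul_exp_sub_le {H M : Matrix ι ι ℝ} (hH : H.IsHermitian) (h0 : M.PosSemidef)
    (h1 : (1 - M).PosSemidef) {s : ℝ} (hs : 0 < s) :
    (M * exp (H + s • M)).trace - (M * exp H).trace ≤
      s / 2 * ((M * exp H).trace + (M * exp (H + s • M)).trace) := by
  have hG : (H + s • M).IsHermitian := (hH.add (h0.isHermitian.smul (IsSelfAdjoint.all s)))
  have h := trace_sub_mul_exp_sub_le hH hG
  have a1 := trace_mul_self_mul_le h0 h1 (posSemidef_exp hH)
  have a2 := trace_mul_self_mul_le h0 h1 (posSemidef_exp hG)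
  simp only [add_sub_cancel_left, Matrix.smul_mul, Matrix.mul_smul, trace_smul, smul_eq_mul] at h
  have h' : s * ((M * exp (H + s • M)).trace - (M * exp H).trace) ≤
      s * (s / 2 * ((M * exp H).trace + (M * exp (H + s • M)).trace)) := by
    nlinarith [mul_le_mul_of_nonneg_left a1 (mul_nonneg hs.le hs.le),
      mul_le_mul_of_nonneg_left a2 (mul_nonneg hs.le hs.le)]
  exact le_of_mul_le_mul_left h' hs

/-- Klein's inequality yields the decrease s·tr(M exp(H - sM)); passing back to H costs the factor
(1 - s/2)/(1 + s/2) ≥ 1 - s. -/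
lemma trace_exp_sub_smul_le {H M : Matrix ι ι ℝ} (hH : H.IsHermitian) (h0 : M.PosSemidef)
    (h1 : (1 - M).PosSemidef) {s : ℝ} (hs : 0 < s) :
    (exp (H - s • M)).trace ≤ (exp H).trace - s * (1 - s) * (M * exp H).trace := by
  have hG : (H - s • M).IsHermitian := hH.sub (h0.isHermitian.smul (IsSelfAdjoint.all s))
  have hr := trace_mul_exp_sub_le hG h0 h1 hs
  rw [sub_add_cancel] at hr
  have hk := trace_exp_sub_le hH hG
  simp only [sub_sub_cancel_left, Matrix.neg_mul, Matrix.smul_mul, trace_neg, trace_smul,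
    smul_eq_mul] at hk
  have p0 := trace_mul_nonneg h0 (posSemidef_exp hH)
  have p1 := trace_mul_nonneg h0 (posSemidef_exp hG)
  set x := (M * exp H).trace
  set z := (M * exp (H - s • M)).trace
  have hxz : (1 - s) * x ≤ z := by
    have h2 : (1 + s / 2) * ((1 - s) * x) ≤ (1 + s / 2) * z := by
      nlinarith [mul_nonneg (mul_nonneg hs.le hs.le) p0]
    exact le_of_mul_le_mul_left h2 (by linarith)
  nlinarith [mul_le_mul_of_nonneg_left hxz hs.le]

/-- A single Klein step would give the factor (1 + s/2)/(1 - s/2), which exceeds 1 + s for 0 < s <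
1. Two half steps give 4(4 + s)/(4 - s)² instead, and this is at most 1 + s once 4 - 7s + s² ≥ 0, as
holds for s ≤ 1/2. -/
lemma trace_exp_add_smul_le {H M : Matrix ι ι ℝ} (hH : H.IsHermitian) (h0 : M.PosSemidef)
    (h1 : (1 - M).PosSemidef) {s : ℝ} (hs : 0 < s) (hs1 : s ≤ 1 / 2) :
    (exp (H + s • M)).trace ≤ (exp H).trace + s * (1 + s) * (M * exp H).trace := by
  have hG : (H + (s / 2) • M).IsHermitian := hH.add (h0.isHermitian.smul (IsSelfAdjoint.all _))
  have hF : (H + s • M).IsHermitian := hH.add (h0.isHermitian.smul (IsSelfAdjoint.all s))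
  have e : H + (s / 2) • M + (s / 2) • M = H + s • M := by
    rw [add_assoc, ← add_smul, add_halves]
  have hr1 := trace_mul_exp_sub_le hH h0 h1 (half_pos hs)
  have hr2 := trace_mul_exp_sub_le hG h0 h1 (half_pos hs)
  have hk1 := trace_exp_sub_le hH hG
  have hk2 := trace_exp_sub_le hG hF
  rw [← e] at hk2 ⊢
  simp only [add_sub_cancel_left, Matrix.smul_mul, trace_smul, smul_eq_mul] at hk1 hk2
  have p0 := trace_mul_nonneg h0 (posSemidef_exp hH)
  set x := (M * exp H).trace
  set z := (M * exp (H + (s / 2) • M)).trace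
  set v := (M * exp (H + (s / 2) • M + (s / 2) • M)).trace
  have hzv : z + v ≤ 2 * (1 + s) * x := by
    have hz : (4 - s) * z ≤ (4 + s) * x := by linarith
    have hv : (4 - s) * v ≤ (4 + s) * z := by linarith
    have hpos : 0 < 4 - s := by linarith
    have hz' : (4 - s) * (8 * z) ≤ (4 - s) * ((4 - s) * (2 * (1 + s) * x)) := by
      nlinarith [mul_nonneg hs.le p0, mul_nonneg (mul_nonneg hs.le p0)
        (by nlinarith : (0 : ℝ) ≤ 4 - 7 * s + s ^ 2)]
    have h8 := le_of_mul_le_mul_left hz' hpos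
    refine le_of_mul_le_mul_left (a := 4 - s) ?_ hpos
    linarith
  nlinarith [mul_le_mul_of_nonneg_left hzv hs.le]

end TraceInequalities

/-! ### The multiplicative weights potential in one block. -/

section Update

variable {n : ℕ}

/-- `S` lies in the width interval that matches its shift `L = ± ℓ`. -/
def ShiftedWidth (S : Matrix (Fin n) (Fin n) ℝ) (ℓ ρ L : ℝ) : Prop :=
  (L = ℓ ∧ InInterval S (-ℓ) ρ) ∨ (L = -ℓ ∧ InInterval S (-ρ) ℓ)

lemma posSemidef_inv_smul {X : Matrix (Fin n) (Fin n) ℝ} {r : ℝ} (hr : 0 < r)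
    (h0 : X.PosSemidef) (h1 : (r • (1 : Matrix (Fin n) (Fin n) ℝ) - X).PosSemidef) :
    (r⁻¹ • X).PosSemidef ∧ (1 - r⁻¹ • X).PosSemidef := by
  refine ⟨h0.smul (inv_nonneg.2 hr.le), ?_⟩
  have := h1.smul (inv_nonneg.2 hr.le)
  rwa [smul_sub, smul_smul, inv_mul_cancel₀ hr.ne', one_smul] at this

/-- One step of the multiplicative weights update. -/
lemma trace_exp_update_le {H S : Matrix (Fin n) (Fin n) ℝ} (hH : H.IsHermitian)
    {β ℓ ρ L : ℝ} (hβ : 0 < β) (hβ2 : β ≤ 1 / 2) (hℓ : 0 < ℓ) (hρ : 0 < ρ)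
    (hS : ShiftedWidth S ℓ ρ L) :
    (exp (H - (β / (ℓ + ρ)) • (S + L • (1 : Matrix (Fin n) (Fin n) ℝ)))).trace ≤
      (exp H).trace - β / (ℓ + ρ) * (1 - β * (L / ℓ)) *
        ((S + L • (1 : Matrix (Fin n) (Fin n) ℝ)) * exp H).trace := by
  have hr : 0 < ℓ + ρ := add_pos hℓ hρ
  rcases hS with ⟨rfl, hl, hu⟩ | ⟨rfl, hl, hu⟩ <;> rw [le_iff] at hl hu
  · set X := S + L • (1 : Matrix (Fin n) (Fin n) ℝ) with hX
    have e0 : S - -L • (1 : Matrix (Fin n) (Fin n) ℝ) = X := by rw [hX]; module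
    have e1 : ρ • (1 : Matrix (Fin n) (Fin n) ℝ) - S =
        (L + ρ) • (1 : Matrix (Fin n) (Fin n) ℝ) - X := by rw [hX]; module
    rw [e0] at hl
    rw [e1] at hu
    obtain ⟨h0, h1⟩ := posSemidef_inv_smul hr hl hu
    have h := trace_exp_sub_smul_le hH h0 h1 hβ
    rw [smul_smul, Matrix.smul_mul, trace_smul, smul_eq_mul, ← div_eq_mul_inv] at h
    refine h.trans_eq ?_
    rw [div_self hℓ.ne']
    ring
  · set X := S + -ℓ • (1 : Matrix (Fin n) (Fin n) ℝ) with hX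
    have e0 : ℓ • (1 : Matrix (Fin n) (Fin n) ℝ) - S = -X := by rw [hX]; module
    have e1 : S - -ρ • (1 : Matrix (Fin n) (Fin n) ℝ) =
        (ℓ + ρ) • (1 : Matrix (Fin n) (Fin n) ℝ) - -X := by rw [hX]; module
    rw [e0] at hu
    rw [e1] at hl
    obtain ⟨h0, h1⟩ := posSemidef_inv_smul hr hu hl
    have h := trace_exp_add_smul_le hH h0 h1 hβ hβ2
    rw [smul_smul, Matrix.smul_mul, trace_smul, smul_eq_mul, ← div_eq_mul_inv, smul_neg,
      ← sub_eq_add_neg, Matrix.neg_mul, trace_neg] at h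
    refine h.trans_eq ?_
    rw [neg_div, div_self hℓ.ne']
    ring

lemma ShiftedWidth.div_eq_one_or_neg_one {S : Matrix (Fin n) (Fin n) ℝ} {ℓ ρ L : ℝ} (hℓ : 0 < ℓ)
    (hS : ShiftedWidth S ℓ ρ L) : L / ℓ = 1 ∨ L / ℓ = -1 := by
  rcases hS with ⟨rfl, -⟩ | ⟨rfl, -⟩
  · exact Or.inl (div_self hℓ.ne')
  · exact Or.inr (by rw [neg_div, div_self hℓ.ne'])

variable {S : ℕ → Matrix (Fin n) (Fin n) ℝ} {L : ℕ → ℝ} {β ℓ ρ η : ℝ} {T : ℕ}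

/-- The exponent of the weight matrix after `t` steps. -/
noncomputable def exponent (S : ℕ → Matrix (Fin n) (Fin n) ℝ) (L : ℕ → ℝ) (β ℓ ρ : ℝ) (t : ℕ) :
    Matrix (Fin n) (Fin n) ℝ :=
  -(β / (ℓ + ρ)) • ∑ τ ∈ Finset.Icc 1 t, (S τ + L τ • (1 : Matrix (Fin n) (Fin n) ℝ))

lemma exponent_succ (t : ℕ) :
    exponent S L β ℓ ρ (t + 1) = exponent S L β ℓ ρ t -
      (β / (ℓ + ρ)) • (S (t + 1) + L (t + 1) • (1 : Matrix (Fin n) (Fin n) ℝ)) := by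
  rw [exponent, exponent, Finset.sum_Icc_succ_top (by omega), smul_add, neg_smul, neg_smul,
    sub_eq_add_neg]

lemma isHermitian_exponent (hS : ∀ t, (S t).IsHermitian) (t : ℕ) :
    (exponent S L β ℓ ρ t).IsHermitian := by
  induction t with
  | zero => simp [exponent]
  | succ t ih =>
    rw [exponent_succ]
    exact ih.sub (((hS _).add (isHermitian_one.smul (IsSelfAdjoint.all _))).smul
      (IsSelfAdjoint.all _))

lemma trace_exp_exponent_le (hS : ∀ t, (S t).IsHermitian) (hβ : 0 < β) (hβ2 : β ≤ 1 / 2)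
    (hℓ : 0 < ℓ) (hρ : 0 < ρ) (hwidth : ∀ t ∈ Finset.Icc 1 T, ShiftedWidth (S t) ℓ ρ (L t))
    (horacle : ∀ t < T, -η * (exp (exponent S L β ℓ ρ t)).trace ≤
      (S (t + 1) * exp (exponent S L β ℓ ρ t)).trace) (t : ℕ) (ht : t ≤ T) :
    (exp (exponent S L β ℓ ρ t)).trace ≤ n * Real.exp (-(β / (ℓ + ρ)) *
      ∑ τ ∈ Finset.Icc 1 t, (1 - β * (L τ / ℓ)) * (L τ - η)) := by
  induction t with
  | zero => simp [exponent, NormedSpace.exp_zero]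
  | succ t ih =>
    have hH : (exponent S L β ℓ ρ t).IsHermitian := isHermitian_exponent hS t
    have hw := hwidth (t + 1) (Finset.mem_Icc.2 ⟨by omega, ht⟩)
    have hstep := trace_exp_update_le hH hβ hβ2 hℓ hρ hw
    have ho := horacle t (by omega)
    have ih := ih (by omega)
    rw [exponent_succ, Finset.sum_Icc_succ_top (by omega), mul_add, Real.exp_add, ← mul_assoc]
    rw [Matrix.add_mul, trace_add, Matrix.smul_mul, Matrix.one_mul, trace_smul, smul_eq_mul]
      at hstep
    have hpos := (posSemidef_exp hH).trace_nonneg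
    have hb : 0 < β / (ℓ + ρ) := div_pos hβ (add_pos hℓ hρ)
    -- This factor is 1 - β or 1 + β; its sign lets the oracle bound be substituted into the step
    -- bound.
    have hc : 0 ≤ 1 - β * (L (t + 1) / ℓ) := by
      rcases hw.div_eq_one_or_neg_one hℓ with h | h <;> rw [h] <;> linarith
    set w := (exp (exponent S L β ℓ ρ t)).trace
    set c := 1 - β * (L (t + 1) / ℓ)
    have h1 : β / (ℓ + ρ) * c * ((L (t + 1) - η) * w) ≤ β / (ℓ + ρ) * c *
        ((S (t + 1) * exp (exponent S L β ℓ ρ t)).trace + L (t + 1) * w) :=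
      mul_le_mul_of_nonneg_left (by linarith) (mul_nonneg hb.le hc)
    have h2 := mul_le_mul_of_nonneg_left
      (Real.add_one_le_exp (-(β / (ℓ + ρ)) * (c * (L (t + 1) - η)))) hpos
    have h3 := mul_le_mul_of_nonneg_right ih
      (Real.exp_pos (-(β / (ℓ + ρ)) * (c * (L (t + 1) - η)))).le
    linarith

/-- The lower bound on the sum of the slacks in one block. -/
lemma posSemidef_sum_add (hn : 0 < n) (hS : ∀ t, (S t).IsHermitian) (hβ : 0 < β)
    (hβ2 : β ≤ 1 / 2) (hℓ : 0 < ℓ) (hρ : 0 < ρ) (hη : 0 ≤ η)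
    (hwidth : ∀ t ∈ Finset.Icc 1 T, ShiftedWidth (S t) ℓ ρ (L t))
    (horacle : ∀ t < T, -η * (exp (exponent S L β ℓ ρ t)).trace ≤
      (S (t + 1) * exp (exponent S L β ℓ ρ t)).trace) :
    (∑ t ∈ Finset.Icc 1 T, S t + (T * (β * ℓ + (1 + β) * η) + (ℓ + ρ) / β * Real.log n) •
      (1 : Matrix (Fin n) (Fin n) ℝ)).PosSemidef := by
  have hr : 0 < ℓ + ρ := add_pos hℓ hρ
  have htr := trace_exp_exponent_le hS hβ hβ2 hℓ hρ hwidth horacle T le_rfl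
  set G := ∑ τ ∈ Finset.Icc 1 T, (1 - β * (L τ / ℓ)) * (L τ - η) with hG
  have hn' : (0 : ℝ) < n := Nat.cast_pos.2 hn
  have hexp : (n : ℝ) * Real.exp (-(β / (ℓ + ρ)) * G) =
      Real.exp (Real.log n + -(β / (ℓ + ρ)) * G) := by rw [Real.exp_add, Real.exp_log hn']
  have hps := posSemidef_smul_one_sub (isHermitian_exponent hS T) (htr.trans_eq hexp)
  have hps2 := hps.smul (div_pos hr hβ).le
  -- Per step the difference (1 - βL/ℓ)(L - η) - L is -βℓ - (1 - β)η for L = ℓ and -βℓ - (1 + β)η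
  -- for L = -ℓ. The second case fixes the error term.
  have hgap : 0 ≤ T * (β * ℓ + (1 + β) * η) + (G - ∑ τ ∈ Finset.Icc 1 T, L τ) := by
    have hT : (T : ℝ) * (β * ℓ + (1 + β) * η) =
        ∑ τ ∈ Finset.Icc 1 T, (β * ℓ + (1 + β) * η) := by
      rw [Finset.sum_const, Nat.card_Icc, Nat.add_sub_cancel, nsmul_eq_mul]
    rw [hT, hG, ← Finset.sum_sub_distrib, ← Finset.sum_add_distrib]
    refine Finset.sum_nonneg fun τ hτ => ?_
    rcases hwidth τ hτ with ⟨h, -⟩ | ⟨h, -⟩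
    · rw [h, div_self hℓ.ne']
      linarith [mul_nonneg hβ.le hη]
    · rw [h, neg_div, div_self hℓ.ne']
      linarith
  have hone : ((T * (β * ℓ + (1 + β) * η) + (G - ∑ τ ∈ Finset.Icc 1 T, L τ)) •
      (1 : Matrix (Fin n) (Fin n) ℝ)).PosSemidef := PosSemidef.one.smul hgap
  convert hps2.add hone using 1
  rw [exponent, smul_sub, smul_smul, smul_smul, Finset.sum_add_distrib, ← Finset.sum_smul]
  have e1 : (ℓ + ρ) / β * -(β / (ℓ + ρ)) = -1 := by field_simp
  have e2 : (ℓ + ρ) / β * (Real.log n + -(β / (ℓ + ρ)) * G) =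
      (ℓ + ρ) / β * Real.log n - G := by
    rw [mul_add, ← mul_assoc, e1]; ring
  rw [e1, e2]
  module

end Update

/-! ### Symmetry, traces and averages of slacks. -/

section Slack

variable {m n : ℕ} {A : Fin m → Matrix (Fin n) (Fin n) ℝ} {C : Matrix (Fin n) (Fin n) ℝ}

lemma isHermitian_slack (hA : ∀ i, (A i).IsSymm) (hC : C.IsSymm) (y : Fin m → ℝ) :
    (slack A C y).IsHermitian := by
  rw [IsHermitian, conjTranspose_eq_transpose_of_trivial, slack, transpose_sub, transpose_sum,
    hC.eq]
  exact congrArg (· - C) (Finset.sum_congr rfl fun i _ => by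
    rw [transpose_smul, (hA i).eq])

lemma trace_slack_mul (y : Fin m → ℝ) (X : Matrix (Fin n) (Fin n) ℝ) :
    (slack A C y * X).trace = ∑ i, y i * traceInner (A i) X - traceInner C X := by
  simp [slack, traceInner, Matrix.sub_mul, Finset.sum_mul, trace_sum]

lemma slack_average {T : ℕ} (hT : 0 < T) (y : ℕ → Fin m → ℝ) :
    slack A C ((1 / (T : ℝ)) • ∑ t ∈ Finset.Icc 1 T, y t) =
      (1 / (T : ℝ)) • ∑ t ∈ Finset.Icc 1 T, slack A C (y t) := by
  have hT' : (T : ℝ) ≠ 0 := Nat.cast_ne_zero.2 hT.ne'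
  have e : ∑ t ∈ Finset.Icc 1 T, ∑ i, y t i • A i = ∑ i, ∑ t ∈ Finset.Icc 1 T, y t i • A i :=
    Finset.sum_comm
  unfold slack
  rw [Finset.sum_sub_distrib, smul_sub, e, Finset.smul_sum (s := Finset.univ)]
  congr 1
  · refine Finset.sum_congr rfl fun i _ => ?_
    rw [← Finset.sum_smul, smul_smul, Pi.smul_apply, Finset.sum_apply, smul_eq_mul]
  · rw [Finset.sum_const, Nat.card_Icc, Nat.add_sub_cancel, ← Nat.cast_smul_eq_nsmul ℝ, smul_smul,
      one_div_mul_cancel hT', one_smul]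

end Slack

end BlockMMWUM

theorem mainTheorem4
    (T K m : ℕ) (n : Fin K → ℕ) (hT : 0 < T) (_hK : 0 < K) (hn : ∀ k, 0 < n k)
    (C : ∀ k, Matrix (Fin (n k)) (Fin (n k)) ℝ)
    (A : Fin m → ∀ k, Matrix (Fin (n k)) (Fin (n k)) ℝ)
    (hC : ∀ k, (C k).IsSymm) (hA : ∀ i k, (A i k).IsSymm)
    (η β : Fin K → ℝ) (hη : ∀ k, 0 < η k) (hβ : ∀ k, 0 < β k ∧ β k ≤ 1 / 2)
    (P N : Fin K → Finset ℕ)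
    (hPN : ∀ k, Disjoint (P k) (N k) ∧ P k ∪ N k = Finset.Icc 1 T)
    (ℓ ρ : Fin K → ℝ) (hℓρ : ∀ k, 0 < ℓ k ∧ ℓ k ≤ ρ k)
    (W : ∀ k, ℕ → Matrix (Fin (n k)) (Fin (n k)) ℝ)
    (L : Fin K → ℕ → ℝ)
    (y : ℕ → Fin m → ℝ)
    (hW : ∀ k, ∀ t ∈ Finset.Icc 0 T,
      W k (t + 1) = NormedSpace.exp
        (-(β k / (ℓ k + ρ k)) • ∑ τ ∈ Finset.Icc 1 t,
          (BlockMMWUM.slack (fun i => A i k) (C k) (y τ) +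
            L k τ • (1 : Matrix (Fin (n k)) (Fin (n k)) ℝ))))
    (hy : ∀ t ∈ Finset.Icc 1 T, BlockMMWUM.SolvesOracle A C η (fun k => W k t) (y t))
    (hwidthP : ∀ k, ∀ t ∈ P k,
      BlockMMWUM.InInterval (BlockMMWUM.slack (fun i => A i k) (C k) (y t)) (-ℓ k) (ρ k))
    (hwidthN : ∀ k, ∀ t ∈ N k,
      BlockMMWUM.InInterval (BlockMMWUM.slack (fun i => A i k) (C k) (y t)) (-ρ k) (ℓ k))
    (hLP : ∀ k, ∀ t ∈ P k, L k t = ℓ k)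
    (hLN : ∀ k, ∀ t ∈ N k, L k t = -ℓ k)
    (ybar : Fin m → ℝ)
    (hybar : ybar = (1 / (T : ℝ)) • ∑ t ∈ Finset.Icc 1 T, y t) :
    ∀ k, BlockMMWUM.slack (fun i => A i k) (C k) ybar ≥
      -(β k * ℓ k + (ρ k + ℓ k) * Real.log (n k) / (T * β k) + (1 + β k) * η k) •
        (1 : Matrix (Fin (n k)) (Fin (n k)) ℝ) := by
  intro k
  subst hybar
  obtain ⟨hℓ, hℓρ⟩ := hℓρ k
  obtain ⟨hβ, hβ2⟩ := hβ k
  have hρ : 0 < ρ k := hℓ.trans_le hℓρ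
  set S : ℕ → Matrix (Fin (n k)) (Fin (n k)) ℝ :=
    fun t => BlockMMWUM.slack (fun i => A i k) (C k) (y t) with hS
  have hwidth : ∀ t ∈ Finset.Icc 1 T, BlockMMWUM.ShiftedWidth (S t) (ℓ k) (ρ k) (L k t) := by
    intro t ht
    rw [← (hPN k).2, Finset.mem_union] at ht
    rcases ht with ht | ht
    · exact Or.inl ⟨hLP k t ht, hwidthP k t ht⟩
    · exact Or.inr ⟨hLN k t ht, hwidthN k t ht⟩
  have horacle : ∀ t < T,
      -η k * (NormedSpace.exp (BlockMMWUM.exponent S (L k) (β k) (ℓ k) (ρ k) t)).trace ≤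
        (S (t + 1) * NormedSpace.exp
          (BlockMMWUM.exponent S (L k) (β k) (ℓ k) (ρ k) t)).trace := by
    intro t ht
    -- The weight matrix of round t + 1 uses only the first t slacks, so `exponent` at t pairs with
    -- the oracle answer of round t + 1.
    have hWt : W k (t + 1) = NormedSpace.exp
        (BlockMMWUM.exponent S (L k) (β k) (ℓ k) (ρ k) t) :=
      hW k t (Finset.mem_Icc.2 ⟨Nat.zero_le t, ht.le⟩)
    have ho := (hy (t + 1) (Finset.mem_Icc.2 ⟨by omega, ht⟩)).1 k
    rw [← hWt, hS, BlockMMWUM.trace_slack_mul]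
    linarith
  have hmain := BlockMMWUM.posSemidef_sum_add (hn k)
    (fun t => BlockMMWUM.isHermitian_slack (fun i => hA i k) (hC k) (y t))
    hβ hβ2 hℓ hρ (hη k).le hwidth horacle
  have hT' : (0 : ℝ) < T := Nat.cast_pos.2 hT
  rw [ge_iff_le, Matrix.le_iff, BlockMMWUM.slack_average hT]
  have e : ((1 / (T : ℝ)) • ∑ t ∈ Finset.Icc 1 T, S t -
      -(β k * ℓ k + (ρ k + ℓ k) * Real.log (n k) / (T * β k) + (1 + β k) * η k) •
        (1 : Matrix (Fin (n k)) (Fin (n k)) ℝ)) = (1 / (T : ℝ)) • (∑ t ∈ Finset.Icc 1 T, S t +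
      (T * (β k * ℓ k + (1 + β k) * η k) + (ℓ k + ρ k) / β k * Real.log (n k)) •
        (1 : Matrix (Fin (n k)) (Fin (n k)) ℝ)) := by
    rw [smul_add, smul_smul, neg_smul, sub_neg_eq_add]
    congr 2
    field_simp
    ring
  exact e ▸ hmain.smul (one_div_pos.2 hT').le
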